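/- Let $\Gamma$ be a (finite, simple, connected) distance-regular graph with diameter $D\ge 3$, valency $k$ and intersection numbers $b_i,c_i$, with smallest eigenvalue $\theta_{\min}$ and second largest (distinct) eigenvalue $\theta_1$. Suppose that $\Gamma$ has classical parameters $(D,b,\alpha,\beta)$ with $b>0$, that is, writing $[j]=1+b+\cdots+b^{j-1}$, $$b_i=([D]-[i])(\beta-\alpha[i])\quad(0\le i\le D-1),\qquad c_i=[i](1+\alpha[i-1])\quad(1\le i\le D).$$ Suppose further that $\Gamma$ is geometric: there is a set of Delsarte cliques (cliques with exactly $1+\frac{k}{-\theta_{\min}}$ vertices) such that every edge lies in exactly one of them. For $j=1,2$ let $\phi_j$ be the number of vertices at distance $j$ from $x$ in a Delsarte clique $C$, where $x$ is any vertex at distance $j$ from $C$. Let $(u_i)_{0\le i\le D}$ be the standard sequence of $\theta_1$: $u_0=1$, $u_1=\theta_1/k$, and $c_iu_{i-1}+(k-b_i-c_i)u_i+b_iu_{i+1}=\theta_1u_i$ for $1\le i\le D-1$. Then $u_1\neq 0$ and 1. $\left(\phi_1-\frac{bu_2}{u_1}\right)^2\ge\left(\beta+\frac1{u_1}\right)\left(\phi_1-b^2-2b-1+\frac1{u_1}\right)$;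 2. $\left(\phi_2-\frac{b^2u_3}{u_1}\right)^2\ge\left(\beta+\frac1{u_1}\right)\left(\phi_2-b^4-2b^3-b^2\left(1+\frac{2u_2-1}{u_1}\right)-1+\frac1{u_1}\right)$. If moreover $b\ge 2$, then 3. $\left(\phi_1+\frac{7b^2}{2}\right)^2\ge\beta\left(\phi_1-b^2-2b-1\right)$; 4. $\left(\phi_2+\frac{7b^3}{2}\right)^2\ge\beta\left(\phi_2-b^4-\frac{11b^3}{2}-b^2-1\right)$. -/

import Mathlib

open scoped BigOperators

/-- The set of eigenvalues of a finite graph: the spectrum of its adjacency matrix over `ℝ`. -/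
def graphEigenvalues {V : Type*} [Fintype V] [DecidableEq V] (G : SimpleGraph V)
    [DecidableRel G.Adj] : Set ℝ :=
  spectrum ℝ (G.adjMatrix ℝ)

/-- `θ` is the smallest eigenvalue of `G`. -/
def IsSmallestEigenvalue {V : Type*} [Fintype V] [DecidableEq V] (G : SimpleGraph V)
    [DecidableRel G.Adj] (θ : ℝ) : Prop :=
  IsLeast (graphEigenvalues G) θ

/-- `θ` is the second largest among the distinct eigenvalues of `G`. -/
def IsSecondLargestEigenvalue {V : Type*} [Fintype V] [DecidableEq V] (G : SimpleGraph V)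
    [DecidableRel G.Adj] (θ : ℝ) : Prop :=
  ∃ θ₀ : ℝ, IsGreatest (graphEigenvalues G) θ₀ ∧ IsGreatest (graphEigenvalues G \ {θ₀}) θ

/-- `G` is a (finite, connected) distance-regular graph with intersection numbers
`bi i` and `ci i`: for vertices `x`, `y` at distance `i`, exactly `bi i` neighbours of `y` are
at distance `i + 1` from `x`, and exactly `ci i` neighbours of `y` are at distance `i - 1`
from `x`. (The values of `bi`, `ci` beyond the diameter play no role.) -/
def IsDistanceRegular {V : Type*} [Fintype V] [DecidableEq V] (G : SimpleGraph V)
    [DecidableRel G.Adj] (bi ci : ℕ → ℕ) : Prop :=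
  G.Connected ∧ ∀ x y : V,
    (Finset.univ.filter fun z => G.Adj y z ∧ G.dist x z = G.dist x y + 1).card
        = bi (G.dist x y) ∧
    (Finset.univ.filter fun z => G.Adj y z ∧ G.dist x z + 1 = G.dist x y).card
        = ci (G.dist x y)

/-- The number `[j] = 1 + b + ⋯ + b ^ (j - 1)`. -/
noncomputable def gaussNumber (b : ℝ) (j : ℕ) : ℝ := ∑ i ∈ Finset.range j, b ^ i

theorem gaussNumber_eq (b : ℝ) (j : ℕ) :
    gaussNumber b j = if b = 1 then (j : ℝ) else (b ^ j - 1) / (b - 1) := by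
  unfold gaussNumber
  split_ifs with h
  · simp [h]
  · exact geom_sum_eq h j

/-- The graph `G`, distance-regular with intersection numbers `bi`, `ci`, has classical
parameters `(D, b, α, β)`; in particular its diameter is `D`. -/
def HasClassicalParameters {V : Type*} [Fintype V] [DecidableEq V] (G : SimpleGraph V)
    [DecidableRel G.Adj] (bi ci : ℕ → ℕ) (D : ℕ) (b α β : ℝ) : Prop :=
  IsDistanceRegular G bi ci ∧ G.diam = D ∧
  (∀ i : ℕ, i < D →
    (bi i : ℝ) = (gaussNumber b D - gaussNumber b i) * (β - α * gaussNumber b i)) ∧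
  (∀ i : ℕ, 1 ≤ i → i ≤ D →
    (ci i : ℝ) = gaussNumber b i * (1 + α * gaussNumber b (i - 1)))

/-- `(u i)`, `0 ≤ i ≤ D`, is the standard sequence corresponding to `θ` for the intersection
numbers `bi`, `ci` and diameter `D`; here the valency is `bi 0` and `a_i = bi 0 - bi i - ci i`. -/
def IsStandardSequence (bi ci : ℕ → ℕ) (D : ℕ) (θ : ℝ) (u : ℕ → ℝ) : Prop :=
  u 0 = 1 ∧ u 1 = θ / (bi 0 : ℝ) ∧
  ∀ i : ℕ, 1 ≤ i → i < D →
    (ci i : ℝ) * u (i - 1) + ((bi 0 : ℝ) - (bi i : ℝ) - (ci i : ℝ)) * u i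
      + (bi i : ℝ) * u (i + 1) = θ * u i

/-- A Delsarte clique of a regular graph with valency `k` and smallest eigenvalue `θ`:
a clique with `1 + k / (-θ)` vertices. -/
def IsDelsarteClique {V : Type*} [Fintype V] [DecidableEq V] (G : SimpleGraph V)
    [DecidableRel G.Adj] (C : Finset V) : Prop :=
  G.IsClique (C : Set V) ∧
  ∃ (k : ℕ) (θ : ℝ), G.IsRegularOfDegree k ∧ IsSmallestEigenvalue G θ ∧
    (C.card : ℝ) = 1 + (k : ℝ) / (-θ)

/-- `G` is geometric: there is a set of Delsarte cliques such that every edge lies in exactly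
one of them. -/
def IsGeometric {V : Type*} [Fintype V] [DecidableEq V] (G : SimpleGraph V)
    [DecidableRel G.Adj] : Prop :=
  ∃ 𝒞 : Set (Finset V), (∀ C ∈ 𝒞, IsDelsarteClique G C) ∧
    ∀ x y : V, G.Adj x y → ∃! C : Finset V, C ∈ 𝒞 ∧ x ∈ C ∧ y ∈ C

/-- The vertex `x` is at distance `j` from the vertex set `C`. -/
def IsDistToSet {V : Type*} (G : SimpleGraph V) (x : V) (C : Finset V) (j : ℕ) : Prop :=
  (∃ y ∈ C, G.dist x y = j) ∧ ∀ y ∈ C, j ≤ G.dist x y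

/-- `p` is the geometric parameter `φ_j`: the number of vertices at distance `j` from `x` in a
Delsarte clique `C`, for some vertex `x` at distance `j` from `C`. No independence of the pair
`(x, C)` is assumed: a statement about every such `p` is a statement about every such pair. -/
def IsGeometricPhi {V : Type*} [Fintype V] [DecidableEq V] (G : SimpleGraph V)
    [DecidableRel G.Adj] (j p : ℕ) : Prop :=
  ∃ (C : Finset V) (x : V), IsDelsarteClique G C ∧ IsDistToSet G x C j ∧
    (C.filter fun y => G.dist x y = j).card = p

/-! For an eigenvalue `θ` with standard sequence `v`, the cosine matrix `U = (v (dist y z))`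
satisfies `U ^ 2 = γ U` with `γ > 0`, hence is positive semidefinite (`exists_pos_mul_quadForm_eq`).
Everything is read off from its restriction to a vertex `x` and a Delsarte clique `C` at distance
`j` from `x`. The clique block depends only on `v 1` and `|C|`, and the row of `x` takes only the
values `v j` and `v (j + 1)`.

For the smallest eigenvalue `-[D]` one gets `|C| = 1 + β`, and the all-ones vector of `C` is
isotropic, so it lies in the kernel of `U`. This forces `φ_j = 1 + α[j]` (`phi_eq`), so `α ≥ 0`. It
follows that `θ₁ = ([D] - 1)(β - α) / b - 1`, with `u_i - u_{i+1} = (1 - u₁) / b ^ i`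
(`eq_classicalTheta`, `classicalCosine_recurrence`).

For `θ₁`, the Schur complement of the clique block is nonnegative (`clique_cosine_le`). Written as a
quadratic condition on `φ_j` and completed to a square (`sq_ge_of_cosine_le`), this is inequality 1
for `j = 1` and inequality 2 for `j = 2`. Inequalities 3 and 4 follow from these by a bound on `1 /
u₁` when `α ≥ b ^ 2 + 2 b`, and are trivial otherwise (`inv_cosine_le`, `sq_ge_of_small`).

Both extremal eigenvalues are identified by a Perron-type argument: a nonnegative eigenvector of the
relevant tridiagonal matrix bounds the spectrum. -/

section DistanceRegular

/-! ### Radial functions and the cosine matrix of an eigenvalue. -/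

variable {V : Type*} [Fintype V] [DecidableEq V] {G : SimpleGraph V} [DecidableRel G.Adj]

/-- The function `f` satisfies the eigenvector equation for `θ` and the adjacency matrix. -/
def IsAdjEigenfunction (G : SimpleGraph V) [DecidableRel G.Adj] (θ : ℝ) (f : V → ℝ) : Prop :=
  ∀ y, ∑ z ∈ G.neighborFinset y, f z = θ * f y

theorem mem_graphEigenvalues_iff {θ : ℝ} :
    θ ∈ graphEigenvalues G ↔ ∃ f : V → ℝ, f ≠ 0 ∧ IsAdjEigenfunction G θ f := by
  unfold graphEigenvalues
  rw [← Matrix.spectrum_toLin', ← Module.End.hasEigenvalue_iff_mem_spectrum]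
  have key : ∀ f : V → ℝ, Matrix.toLin' (G.adjMatrix ℝ) f = θ • f ↔
      IsAdjEigenfunction G θ f := by
    intro f
    rw [funext_iff]
    simp [IsAdjEigenfunction, Matrix.toLin'_apply, SimpleGraph.adjMatrix_mulVec_apply]
  constructor
  · intro h
    obtain ⟨f, hf⟩ := h.exists_hasEigenvector
    exact ⟨f, hf.2, (key f).1 hf.apply_eq_smul⟩
  · rintro ⟨f, hf0, hf⟩
    exact Module.End.hasEigenvalue_of_hasEigenvector
      (Module.End.hasEigenvector_iff.2 ⟨Module.End.mem_eigenspace_iff.2 ((key f).2 hf), hf0⟩)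

/-- The action of the adjacency matrix on functions of the distance to a fixed vertex. -/
def radialOp (bi ci : ℕ → ℕ) (g : ℕ → ℝ) (i : ℕ) : ℝ :=
  (bi 0 : ℝ) * g i + (bi i : ℝ) * (g (i + 1) - g i) + (ci i : ℝ) * (g (i - 1) - g i)

theorem IsDistanceRegular.degree_eq {bi ci : ℕ → ℕ} (h : IsDistanceRegular G bi ci) (x : V) :
    G.degree x = bi 0 := by
  have h1 := (h.2 x x).1
  rw [SimpleGraph.dist_self] at h1
  rw [← h1, ← SimpleGraph.card_neighborFinset_eq_degree]
  congr 1
  ext z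
  simp only [SimpleGraph.mem_neighborFinset, Finset.mem_filter, Finset.mem_univ, true_and,
    zero_add, SimpleGraph.dist_eq_one_iff_adj, and_self]

theorem IsDistanceRegular.sum_neighborFinset_radial {bi ci : ℕ → ℕ}
    (h : IsDistanceRegular G bi ci) (x y : V) (g : ℕ → ℝ) :
    ∑ z ∈ G.neighborFinset y, g (G.dist x z) = radialOp bi ci g (G.dist x y) := by
  have hpt : ∀ z ∈ G.neighborFinset y, g (G.dist x z) = g (G.dist x y)
      + (if G.dist x z = G.dist x y + 1 then g (G.dist x y + 1) - g (G.dist x y) else 0)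
      + (if G.dist x z + 1 = G.dist x y then g (G.dist x y - 1) - g (G.dist x y) else 0) := by
    intro z hz
    rw [SimpleGraph.mem_neighborFinset] at hz
    have t1 := h.1.dist_triangle (u := x) (v := y) (w := z)
    have t2 := h.1.dist_triangle (u := x) (v := z) (w := y)
    rw [SimpleGraph.dist_eq_one_iff_adj.2 hz] at t1
    rw [SimpleGraph.dist_eq_one_iff_adj.2 hz.symm] at t2
    by_cases h1 : G.dist x z = G.dist x y + 1
    · have h2 : ¬ (G.dist x z + 1 = G.dist x y) := by omega
      rw [if_pos h1, if_neg h2, h1]; ring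
    · by_cases h2 : G.dist x z + 1 = G.dist x y
      · have h3 : G.dist x y - 1 = G.dist x z := by omega
        rw [if_neg h1, if_pos h2, h3]; ring
      · have h3 : G.dist x z = G.dist x y := by omega
        rw [if_neg h1, if_neg h2, h3]; ring
  have hf1 : (G.neighborFinset y).filter (fun z => G.dist x z = G.dist x y + 1)
      = Finset.univ.filter fun z => G.Adj y z ∧ G.dist x z = G.dist x y + 1 := by
    ext z; simp
  have hf2 : (G.neighborFinset y).filter (fun z => G.dist x z + 1 = G.dist x y)
      = Finset.univ.filter fun z => G.Adj y z ∧ G.dist x z + 1 = G.dist x y := by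
    ext z; simp
  rw [Finset.sum_congr rfl hpt, Finset.sum_add_distrib, Finset.sum_add_distrib,
    ← Finset.sum_filter, ← Finset.sum_filter, hf1, hf2]
  simp only [Finset.sum_const, nsmul_eq_mul, (h.2 x y).1, (h.2 x y).2,
    SimpleGraph.card_neighborFinset_eq_degree, h.degree_eq, radialOp]

omit [DecidableEq V] in
/-- The adjacency matrix is symmetric. -/
theorem sum_mul_sum_neighborFinset (f g : V → ℝ) :
    ∑ w, f w * ∑ z ∈ G.neighborFinset w, g z = ∑ w, (∑ z ∈ G.neighborFinset w, f z) * g w := by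
  simp only [Finset.mul_sum, Finset.sum_mul]
  rw [Finset.sum_comm']
  intro x y
  simp [SimpleGraph.adj_comm]

/-- Self-adjointness of the adjacency matrix moves it from `f` onto the radial function, turning
spectral questions into tridiagonal ones. -/
theorem IsDistanceRegular.eigenvalue_mul_pairing {bi ci : ℕ → ℕ} (h : IsDistanceRegular G bi ci)
    {θ : ℝ} {f : V → ℝ} (hf : IsAdjEigenfunction G θ f) (x : V) (g : ℕ → ℝ) :
    θ * ∑ w, f w * g (G.dist x w) = ∑ w, f w * radialOp bi ci g (G.dist x w) := by
  have h1 := sum_mul_sum_neighborFinset (G := G) f (fun w => g (G.dist x w))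
  simp only [h.sum_neighborFinset_radial] at h1
  rw [h1, Finset.mul_sum]
  refine Finset.sum_congr rfl fun w _ => ?_
  rw [hf w]; ring

theorem IsDistanceRegular.ci_zero {bi ci : ℕ → ℕ} (h : IsDistanceRegular G bi ci) :
    ci 0 = 0 := by
  obtain ⟨x⟩ := h.1.nonempty
  have h1 := (h.2 x x).2
  rw [SimpleGraph.dist_self] at h1
  rw [← h1]
  simp

theorem IsDistanceRegular.dist_le {bi ci : ℕ → ℕ} (h : IsDistanceRegular G bi ci) (x y : V) :
    G.dist x y ≤ G.diam := by
  have := h.1.nonempty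
  exact SimpleGraph.dist_le_diam (SimpleGraph.connected_iff_ediam_ne_top.1 h.1)

omit [Fintype V] [DecidableEq V] [DecidableRel G.Adj] in
theorem SimpleGraph.Connected.exists_adj_dist_eq (h : G.Connected) {i : ℕ} (hi : i < G.diam) :
    ∃ x y z, G.Adj y z ∧ G.dist x y = i ∧ G.dist x z = i + 1 := by
  have := h.nonempty
  obtain ⟨x, y, hxy⟩ := G.exists_dist_eq_diam
  have step : ∀ n : ℕ, ∀ z, G.dist x z = n + 1 → ∃ y, G.Adj y z ∧ G.dist x y = n := by
    intro n z hz
    obtain ⟨p, hp⟩ := h.exists_walk_length_eq_dist x z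
    have hnil : ¬ p.Nil := by
      intro hn
      have := SimpleGraph.Walk.length_eq_zero_iff.2 hn
      omega
    have hadj := p.adj_penultimate hnil
    refine ⟨p.penultimate, hadj, ?_⟩
    have h1 := SimpleGraph.dist_le p.dropLast
    have h2 : p.dropLast.length + 1 = p.length := SimpleGraph.Walk.length_dropLast_add_one hnil
    have h3 := h.dist_triangle (u := x) (v := p.penultimate) (w := z)
    rw [SimpleGraph.dist_eq_one_iff_adj.2 hadj] at h3
    omega
  have down : ∀ m : ℕ, m ≤ G.diam → ∃ z, G.dist x z = G.diam - m := by
    intro m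
    induction m with
    | zero => intro _; exact ⟨y, hxy⟩
    | succ m ih =>
      intro hm
      obtain ⟨z, hz⟩ := ih (by omega)
      obtain ⟨w, -, hw⟩ := step (G.diam - (m + 1)) z (by omega)
      exact ⟨w, hw⟩
  obtain ⟨z, hz⟩ := down (G.diam - (i + 1)) (by omega)
  have hz' : G.dist x z = i + 1 := by omega
  obtain ⟨w, hw, hw'⟩ := step i z hz'
  exact ⟨x, w, z, hw, hw', hz'⟩

theorem IsDistanceRegular.bi_pos {bi ci : ℕ → ℕ} (h : IsDistanceRegular G bi ci) {i : ℕ}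
    (hi : i < G.diam) : 0 < bi i := by
  obtain ⟨x, y, z, hyz, hy, hz⟩ := h.1.exists_adj_dist_eq hi
  have h1 := (h.2 x y).1
  rw [hy] at h1
  rw [← h1, Finset.card_pos]
  exact ⟨z, by simp [hyz, hz]⟩

theorem IsDistanceRegular.ci_pos {bi ci : ℕ → ℕ} (h : IsDistanceRegular G bi ci) {i : ℕ}
    (hi : i < G.diam) : 0 < ci (i + 1) := by
  obtain ⟨x, y, z, hyz, hy, hz⟩ := h.1.exists_adj_dist_eq hi
  have h1 := (h.2 x z).2
  rw [hz] at h1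
  rw [← h1, Finset.card_pos]
  exact ⟨y, by simp [hyz.symm, hy]⟩

theorem IsDistanceRegular.bi_diam {bi ci : ℕ → ℕ} (h : IsDistanceRegular G bi ci) :
    bi G.diam = 0 := by
  have := h.1.nonempty
  obtain ⟨x, y, hxy⟩ := G.exists_dist_eq_diam
  have h1 := (h.2 x y).1
  rw [hxy] at h1
  rw [← h1, Finset.card_eq_zero, Finset.filter_eq_empty_iff]
  rintro z - ⟨-, hz⟩
  have := h.dist_le x z
  omega

theorem IsDistanceRegular.isAdjEigenfunction_radial {bi ci : ℕ → ℕ}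
    (h : IsDistanceRegular G bi ci) {θ : ℝ} {v : ℕ → ℝ}
    (hv : ∀ i ≤ G.diam, radialOp bi ci v i = θ * v i) (x : V) :
    IsAdjEigenfunction G θ fun y => v (G.dist x y) := by
  intro y
  rw [h.sum_neighborFinset_radial, hv _ (h.dist_le x y)]

theorem IsDistanceRegular.mem_graphEigenvalues_of_radial {bi ci : ℕ → ℕ}
    (h : IsDistanceRegular G bi ci) {θ : ℝ} {v : ℕ → ℝ}
    (hv : ∀ i ≤ G.diam, radialOp bi ci v i = θ * v i) (hv0 : v 0 ≠ 0) :
    θ ∈ graphEigenvalues G := by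
  obtain ⟨x⟩ := h.1.nonempty
  refine mem_graphEigenvalues_iff.2 ⟨_, fun h0 => hv0 ?_, h.isAdjEigenfunction_radial hv x⟩
  have := congrFun h0 x
  simpa using this

/-- The sums of an eigenfunction over the sphere of radius `i` around `x` are proportional to its
value at `x`, with a factor that depends only on the eigenvalue and `i`. -/
theorem IsDistanceRegular.exists_sphere_sum_eq {bi ci : ℕ → ℕ} (h : IsDistanceRegular G bi ci)
    (θ : ℝ) (i : ℕ) : ∃ s : ℝ, ∀ f, IsAdjEigenfunction G θ f → ∀ x,
      ∑ w, f w * (if G.dist x w = i then 1 else 0) = s * f x := by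
  induction i using Nat.strong_induction_on with
  | _ i ih =>
    rcases i with _ | i
    · refine ⟨1, fun f _ x => ?_⟩
      simp [h.1.dist_eq_zero_iff]
    by_cases hi : G.diam < i + 1
    · refine ⟨0, fun f _ x => ?_⟩
      rw [zero_mul]
      refine Finset.sum_eq_zero fun w _ => ?_
      have := h.dist_le x w
      rw [if_neg (by omega), mul_zero]
    obtain ⟨s, hs⟩ := ih i (by omega)
    -- The contribution of the sphere of radius `i - 1`, which is absent when `i = 0`.
    have hprev : ∃ r : ℝ, ∀ f, IsAdjEigenfunction G θ f → ∀ x,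
        ∑ w, f w * ((bi (G.dist x w) : ℝ) * (if G.dist x w + 1 = i then 1 else 0)) = r * f x := by
      rcases i with _ | j
      · exact ⟨0, fun f _ x => by simp⟩
      · obtain ⟨r, hr⟩ := ih j (by omega)
        refine ⟨bi j * r, fun f hf x => ?_⟩
        rw [mul_assoc, ← hr f hf x, Finset.mul_sum]
        refine Finset.sum_congr rfl fun w _ => ?_
        by_cases hw : G.dist x w = j
        · simp [hw]; ring
        · simp [hw]
    obtain ⟨r, hr⟩ := hprev
    have hc : (ci (i + 1) : ℝ) ≠ 0 := by
      have := h.ci_pos (i := i) (by omega)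
      positivity
    refine ⟨(θ * s - ((bi 0 : ℝ) - bi i - ci i) * s - r) / ci (i + 1), fun f hf x => ?_⟩
    -- Pairing with the indicator of radius `i` gives a three-term recurrence, solvable for radius
    -- `i + 1` because `c_{i+1} ≠ 0`.
    have hp := h.eigenvalue_mul_pairing hf x (fun j => if j = i then 1 else 0)
    have hL : ∀ j, radialOp bi ci (fun j => if j = i then (1 : ℝ) else 0) j
        = ((bi 0 : ℝ) - bi i - ci i) * (if j = i then 1 else 0)
          + (bi j : ℝ) * (if j + 1 = i then 1 else 0)
          + (ci (i + 1) : ℝ) * (if j = i + 1 then 1 else 0) := by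
      intro j
      rcases j with _ | j
      · simp only [radialOp, h.ci_zero]
        by_cases h0 : 0 = i
        · subst h0; simp [h.ci_zero]
        · simp [h0]
      · simp only [radialOp, Nat.add_sub_cancel]
        by_cases h0 : j + 1 = i
        · subst h0; simp; ring
        · by_cases h1 : j = i
          · subst h1; simp
          · simp [h0, h1]
    simp only [hL, mul_add, Finset.sum_add_distrib] at hp
    rw [hr f hf x, hs f hf x] at hp
    have e1 : ∑ w, f w * (((bi 0 : ℝ) - bi i - ci i) * (if G.dist x w = i then 1 else 0))
        = ((bi 0 : ℝ) - bi i - ci i) * (s * f x) := by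
      rw [← hs f hf x, Finset.mul_sum]
      exact Finset.sum_congr rfl fun w _ => by ring
    have e2 : ∑ w, f w * ((ci (i + 1) : ℝ) * (if G.dist x w = i + 1 then 1 else 0))
        = (ci (i + 1) : ℝ) * ∑ w, f w * (if G.dist x w = i + 1 then 1 else 0) := by
      rw [Finset.mul_sum]
      exact Finset.sum_congr rfl fun w _ => by ring
    rw [e1, e2] at hp
    field_simp
    linarith

/-- The cosine matrix of an eigenvalue is, up to a positive factor, idempotent. -/
theorem IsDistanceRegular.exists_pos_mul_quadForm_eq {bi ci : ℕ → ℕ}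
    (h : IsDistanceRegular G bi ci) {θ : ℝ} {v : ℕ → ℝ}
    (hv : ∀ i ≤ G.diam, radialOp bi ci v i = θ * v i) (hv0 : v 0 = 1) :
    ∃ γ : ℝ, 0 < γ ∧ ∀ p : V → ℝ,
      γ * ∑ y, ∑ z, p y * p z * v (G.dist y z) = ∑ x, (∑ y, p y * v (G.dist x y)) ^ 2 := by
  choose s hs using h.exists_sphere_sum_eq θ
  set γ : ℝ := ∑ i ∈ Finset.range (G.diam + 1), v i * s i with hγ
  -- `U` acts on the whole `θ`-eigenspace as the scalar `γ`. Its columns lie in that space, whence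
  -- `U ^ 2 = γ U`.
  have hU : ∀ f, IsAdjEigenfunction G θ f → ∀ x, ∑ w, f w * v (G.dist x w) = γ * f x := by
    intro f hf x
    have h1 : ∀ w, f w * v (G.dist x w) = ∑ i ∈ Finset.range (G.diam + 1),
        v i * (f w * (if G.dist x w = i then 1 else 0)) := by
      intro w
      have := h.dist_le x w
      rw [Finset.sum_eq_single (G.dist x w)]
      · simp; ring
      · intro j _ hj; simp [hj.symm]
      · intro hj; simp at hj; omega
    rw [Finset.sum_congr rfl fun w _ => h1 w, Finset.sum_comm, hγ, Finset.sum_mul]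
    refine Finset.sum_congr rfl fun i _ => ?_
    rw [← Finset.mul_sum, hs i f hf x]; ring
  have hsq : ∀ y z, ∑ x, v (G.dist x y) * v (G.dist x z) = γ * v (G.dist y z) := by
    intro y z
    rw [← SimpleGraph.dist_comm (u := z), ← hU _ (h.isAdjEigenfunction_radial hv z) y]
    refine Finset.sum_congr rfl fun x _ => ?_
    rw [SimpleGraph.dist_comm (u := x) (v := y), SimpleGraph.dist_comm (u := x) (v := z)]
    ring
  refine ⟨γ, ?_, fun p => ?_⟩
  -- A diagonal entry of `U ^ 2 = γ U` reads `γ = ∑ y, v (dist y x) ^ 2 ≥ v 0 ^ 2 = 1`.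
  · obtain ⟨x⟩ := h.1.nonempty
    have h1 := hsq x x
    rw [SimpleGraph.dist_self, hv0, mul_one] at h1
    rw [← h1]
    have h2 := Finset.single_le_sum (f := fun y => v (G.dist y x) * v (G.dist y x))
      (fun y _ => mul_self_nonneg _) (Finset.mem_univ x)
    simp only [SimpleGraph.dist_self, hv0] at h2
    linarith
  · have hx : ∀ x, (∑ y, p y * v (G.dist x y)) ^ 2
        = ∑ y, ∑ z, p y * v (G.dist x y) * (p z * v (G.dist x z)) := fun x => by
      rw [sq, Finset.sum_mul_sum]
    rw [Finset.sum_congr rfl fun x _ => hx x, Finset.mul_sum]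
    conv_rhs => rw [Finset.sum_comm]
    refine Finset.sum_congr rfl fun y _ => ?_
    rw [Finset.mul_sum]
    conv_rhs => rw [Finset.sum_comm]
    refine Finset.sum_congr rfl fun z _ => ?_
    rw [mul_left_comm, ← hsq, Finset.mul_sum]
    exact Finset.sum_congr rfl fun x _ => by ring

end DistanceRegular

/-! ### Bounding eigenvalues by nonnegative vectors. -/

section Perron

variable {V : Type*} [Fintype V] [DecidableEq V] {G : SimpleGraph V} [DecidableRel G.Adj]

theorem exists_abs_le_one_mul_eq_abs (t : ℝ) : ∃ σ : ℝ, |σ| ≤ 1 ∧ t * σ = |t| := by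
  rcases le_total 0 t with ht | ht
  · exact ⟨1, by simp, by rw [abs_of_nonneg ht, mul_one]⟩
  · exact ⟨-1, by simp, by rw [abs_of_nonpos ht, mul_neg_one]⟩

theorem mul_le_abs_mul_of_abs_le {t s m : ℝ} (h : |s| ≤ m) : t * s ≤ |t| * m :=
  (le_abs_self _).trans ((abs_mul t s).le.trans (mul_le_mul_of_nonneg_left h (abs_nonneg t)))

/-- A nonnegative vector `m` for the negated intersection matrix bounds the smallest eigenvalue. -/
theorem IsDistanceRegular.neg_le_of_mem_graphEigenvalues {bi ci : ℕ → ℕ}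
    (h : IsDistanceRegular G bi ci) {m : ℕ → ℝ} {ρ : ℝ} (hm : ∀ i, 0 ≤ m i) (hm0 : 0 < m 0)
    (hρ : ∀ i ≤ G.diam,
      (ci i : ℝ) * m (i - 1) - ((bi 0 : ℝ) - bi i - ci i) * m i + bi i * m (i + 1) ≤ ρ * m i)
    {θ : ℝ} (hθ : θ ∈ graphEigenvalues G) : -ρ ≤ θ := by
  obtain ⟨f, hf0, hf⟩ := mem_graphEigenvalues_iff.1 hθ
  obtain ⟨x, hx⟩ := Function.ne_iff.1 hf0
  set S : ℕ → ℝ := fun i => ∑ w, f w * (if G.dist x w = i then 1 else 0) with hS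
  have hsum : ∀ g : ℕ → ℝ, ∑ w, f w * g (G.dist x w)
      = ∑ i ∈ Finset.range (G.diam + 1), S i * g i := by
    intro g
    simp only [hS, Finset.sum_mul]
    rw [Finset.sum_comm]
    refine Finset.sum_congr rfl fun w _ => ?_
    have := h.dist_le x w
    rw [Finset.sum_eq_single (G.dist x w)]
    · simp
    · intro j _ hj; simp [hj.symm]
    · intro hj; simp at hj; omega
  -- Giving `m` the signs of the sphere sums makes the pairing equal to `∑ |S i| * m i`, which is
  -- positive since `S 0 = f x ≠ 0`.
  choose σ hσ1 hσ2 using fun i => exists_abs_le_one_mul_eq_abs (S i)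
  set g : ℕ → ℝ := fun i => σ i * m i with hg
  have hgm : ∀ i, |-g i| ≤ m i := fun i => by
    rw [abs_neg, hg]
    simp only [abs_mul, abs_of_nonneg (hm i)]
    exact mul_le_of_le_one_left (hm i) (hσ1 i)
  have hSg : ∀ i, S i * g i = |S i| * m i := fun i => by
    rw [← hσ2 i, hg]; ring
  have hp := h.eigenvalue_mul_pairing hf x g
  rw [hsum, hsum] at hp
  have hle : ∑ i ∈ Finset.range (G.diam + 1), S i * -radialOp bi ci g i
      ≤ ∑ i ∈ Finset.range (G.diam + 1), ρ * (|S i| * m i) := by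
    refine Finset.sum_le_sum fun i hi => ?_
    have h1 := mul_le_abs_mul_of_abs_le (t := S i) (hgm (i - 1))
    have h2 := mul_le_abs_mul_of_abs_le (t := S i) (hgm (i + 1))
    have h3 := mul_le_mul_of_nonneg_left (hρ i (by simpa [Nat.lt_succ_iff] using hi))
      (abs_nonneg (S i))
    have h4 := mul_le_mul_of_nonneg_left h1 (Nat.cast_nonneg (α := ℝ) (ci i))
    have h5 := mul_le_mul_of_nonneg_left h2 (Nat.cast_nonneg (α := ℝ) (bi i))
    calc S i * -radialOp bi ci g i
        = (ci i : ℝ) * (S i * -g (i - 1)) - ((bi 0 : ℝ) - bi i - ci i) * (S i * g i)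
          + (bi i : ℝ) * (S i * -g (i + 1)) := by unfold radialOp; ring
      _ ≤ _ := by rw [hSg]; linarith
  have hpos : 0 < ∑ i ∈ Finset.range (G.diam + 1), |S i| * m i := by
    refine Finset.sum_pos' (fun i _ => mul_nonneg (abs_nonneg _) (hm i)) ⟨0, by simp, ?_⟩
    refine mul_pos (abs_pos.2 ?_) hm0
    simpa [hS, h.1.dist_eq_zero_iff] using hx
  simp only [mul_neg, Finset.sum_neg_distrib, ← hp, ← Finset.mul_sum, hSg] at hle
  by_contra hcon
  nlinarith

/-- Abel summation: it replaces sphere sums by the ball sums `W i`, paired with differences of `g`.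
The constant `g n` drops out against a function of sum zero. -/
theorem eq_add_sum_range_ite (g : ℕ → ℝ) {d n : ℕ} (hd : d ≤ n) :
    g d = g n + ∑ i ∈ Finset.range n, (if d ≤ i then 1 else 0) * (g i - g (i + 1)) := by
  induction n, hd using Nat.le_induction with
  | base =>
    rw [Finset.sum_eq_zero, add_zero]
    intro i hi
    rw [if_neg (by simpa using hi), zero_mul]
  | succ n hn ih =>
    rw [Finset.sum_range_succ, if_pos hn]
    linarith

/-- A nonnegative vector `m` for the matrix acting on the differences of radial functions bounds
the eigenvalues other than the valency. -/
theorem IsDistanceRegular.le_of_mem_graphEigenvalues_of_ne {bi ci : ℕ → ℕ}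
    (h : IsDistanceRegular G bi ci) {m : ℕ → ℝ} {ρ : ℝ} (hm : ∀ i, 0 ≤ m i) (hm0 : 0 < m 0)
    (hD : 0 < G.diam)
    (hρ : ∀ i < G.diam,
      (ci i : ℝ) * m (i - 1) + ((bi 0 : ℝ) - bi i - ci (i + 1)) * m i + bi (i + 1) * m (i + 1)
        ≤ ρ * m i)
    {θ : ℝ} (hθ : θ ∈ graphEigenvalues G) (hne : θ ≠ bi 0) : θ ≤ ρ := by
  obtain ⟨f, hf0, hf⟩ := mem_graphEigenvalues_iff.1 hθ
  obtain ⟨x, hx⟩ := Function.ne_iff.1 hf0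
  have hf1 : ∑ w, f w = 0 := by
    have hp := h.eigenvalue_mul_pairing hf x (fun _ => 1)
    simp only [radialOp, mul_one, sub_self, mul_zero, add_zero, ← Finset.sum_mul] at hp
    have : (θ - bi 0) * ∑ w, f w = 0 := by linarith
    exact (mul_eq_zero.1 this).resolve_left (sub_ne_zero.2 hne)
  set W : ℕ → ℝ := fun i => ∑ w, f w * (if G.dist x w ≤ i then 1 else 0) with hW
  have hsum : ∀ g : ℕ → ℝ, ∑ w, f w * g (G.dist x w)
      = ∑ i ∈ Finset.range G.diam, W i * (g i - g (i + 1)) := by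
    intro g
    rw [Finset.sum_congr rfl fun w _ => by rw [eq_add_sum_range_ite g (h.dist_le x w)]]
    simp only [hW, mul_add, Finset.sum_add_distrib, ← Finset.sum_mul, hf1, zero_mul, zero_add,
      Finset.mul_sum]
    rw [Finset.sum_comm]
    refine Finset.sum_congr rfl fun i _ => ?_
    rw [Finset.sum_mul]
    exact Finset.sum_congr rfl fun w _ => by ring
  choose σ hσ1 hσ2 using fun i => exists_abs_le_one_mul_eq_abs (W i)
  -- The function vanishing from the diameter on whose successive differences are the signed weights
  -- `σ i * m i`.
  set g : ℕ → ℝ := fun i => ∑ j ∈ Finset.Ico i G.diam, σ j * m j with hg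
  have hstep : ∀ i < G.diam, g i - g (i + 1) = σ i * m i := fun i hi => by
    rw [hg]; simp only [Finset.sum_eq_sum_Ico_succ_bot hi]; ring
  have hgm : ∀ i, |g i - g (i + 1)| ≤ m i := fun i => by
    by_cases hi : i < G.diam
    · rw [hstep i hi, abs_mul, abs_of_nonneg (hm i)]
      exact mul_le_of_le_one_left (hm i) (hσ1 i)
    · have h1 : g i = 0 := by simp [hg, not_lt.1 hi]
      have h2 : g (i + 1) = 0 := by simp [hg, (not_lt.1 hi).trans (Nat.le_succ i)]
      rw [h1, h2, sub_self, abs_zero]; exact hm i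
  have hWg : ∀ i < G.diam, W i * (g i - g (i + 1)) = |W i| * m i := fun i hi => by
    rw [hstep i hi, ← hσ2 i]; ring
  have hp := h.eigenvalue_mul_pairing hf x g
  rw [hsum, hsum, Finset.sum_congr rfl fun i hi => hWg i (Finset.mem_range.1 hi)] at hp
  have hle : ∑ i ∈ Finset.range G.diam, W i * (radialOp bi ci g i - radialOp bi ci g (i + 1))
      ≤ ∑ i ∈ Finset.range G.diam, ρ * (|W i| * m i) := by
    refine Finset.sum_le_sum fun i hi => ?_
    have hi' := Finset.mem_range.1 hi
    have h2 := mul_le_abs_mul_of_abs_le (t := W i) (hgm (i + 1))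
    have h3 := mul_le_mul_of_nonneg_left (hρ i hi') (abs_nonneg (W i))
    have h5 := mul_le_mul_of_nonneg_left h2 (Nat.cast_nonneg (α := ℝ) (bi (i + 1)))
    have h4 : (ci i : ℝ) * (W i * (g (i - 1) - g i)) ≤ ci i * (|W i| * m (i - 1)) := by
      rcases i with _ | j
      · simp [h.ci_zero]
      · exact mul_le_mul_of_nonneg_left (mul_le_abs_mul_of_abs_le (hgm j)) (Nat.cast_nonneg _)
    calc W i * (radialOp bi ci g i - radialOp bi ci g (i + 1))
        = (ci i : ℝ) * (W i * (g (i - 1) - g i))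
          + ((bi 0 : ℝ) - bi i - ci (i + 1)) * (W i * (g i - g (i + 1)))
          + (bi (i + 1) : ℝ) * (W i * (g (i + 1) - g (i + 1 + 1))) := by
            simp only [radialOp, Nat.add_sub_cancel]; ring
      _ ≤ _ := by rw [hWg i hi']; linarith
  have hpos : 0 < ∑ i ∈ Finset.range G.diam, |W i| * m i := by
    refine Finset.sum_pos' (fun i _ => mul_nonneg (abs_nonneg _) (hm i)) ⟨0, by simpa, ?_⟩
    refine mul_pos (abs_pos.2 ?_) hm0
    simpa [hW, h.1.dist_eq_zero_iff] using hx
  rw [← hp, ← Finset.mul_sum] at hle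
  exact le_of_mul_le_mul_right hle hpos

end Perron

/-! ### The numbers `[j]`. -/

section GaussNumber

theorem gaussNumber_zero (b : ℝ) : gaussNumber b 0 = 0 := by simp [gaussNumber]

theorem gaussNumber_succ (b : ℝ) (i : ℕ) : gaussNumber b (i + 1) = 1 + b * gaussNumber b i := by
  unfold gaussNumber
  rw [Finset.sum_range_succ', Finset.mul_sum, pow_zero, add_comm]
  congr 1
  exact Finset.sum_congr rfl fun j _ => by ring

theorem gaussNumber_one (b : ℝ) : gaussNumber b 1 = 1 := by simp [gaussNumber]

theorem gaussNumber_two (b : ℝ) : gaussNumber b 2 = 1 + b := by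
  rw [gaussNumber_succ, gaussNumber_one, mul_one]

theorem sub_one_mul_gaussNumber (b : ℝ) (i : ℕ) : (b - 1) * gaussNumber b i = b ^ i - 1 := by
  rw [mul_comm]; exact geom_sum_mul b i

theorem gaussNumber_strictMono {b : ℝ} (hb : 0 < b) : StrictMono (gaussNumber b) :=
  strictMono_nat_of_lt_succ fun i => by
    unfold gaussNumber
    rw [Finset.sum_range_succ]
    have := pow_pos hb i
    linarith

theorem gaussNumber_nonneg {b : ℝ} (hb : 0 < b) (i : ℕ) : 0 ≤ gaussNumber b i :=
  Finset.sum_nonneg fun j _ => (pow_pos hb j).le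

theorem sum_inv_pow_eq {b : ℝ} (hb : 0 < b) (i : ℕ) :
    ∑ j ∈ Finset.range i, b⁻¹ ^ j = b * b⁻¹ ^ i * gaussNumber b i := by
  induction i with
  | zero => simp [gaussNumber_zero]
  | succ i ih =>
    rw [Finset.sum_range_succ, ih, gaussNumber_succ, pow_succ]
    field_simp
    ring

end GaussNumber

/-! ### Classical parameters: smallest eigenvalue and size of Delsarte cliques. -/

section Classical

variable {V : Type*} [Fintype V] [DecidableEq V] {G : SimpleGraph V} [DecidableRel G.Adj]
  {bi ci : ℕ → ℕ} {D : ℕ} {b α β : ℝ}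

namespace HasClassicalParameters

theorem bi_eq (hc : HasClassicalParameters G bi ci D b α β) {i : ℕ} (hi : i ≤ D) :
    (bi i : ℝ) = (gaussNumber b D - gaussNumber b i) * (β - α * gaussNumber b i) := by
  rcases hi.lt_or_eq with h | h
  · exact hc.2.2.1 i h
  · rw [h, sub_self, zero_mul, ← hc.2.1, hc.1.bi_diam, Nat.cast_zero]

theorem ci_eq (hc : HasClassicalParameters G bi ci D b α β) {i : ℕ} (hi : i ≤ D) :
    (ci i : ℝ) = gaussNumber b i * (1 + α * gaussNumber b (i - 1)) := by
  rcases i.eq_zero_or_pos with h | h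
  · rw [h, gaussNumber_zero, zero_mul, hc.1.ci_zero, Nat.cast_zero]
  · exact hc.2.2.2 i h hi

theorem mul_ci_eq (hc : HasClassicalParameters G bi ci D b α β) {i : ℕ} (hi : i ≤ D) :
    b * (ci i : ℝ) = gaussNumber b i * (b + α * (gaussNumber b i - 1)) := by
  rw [hc.ci_eq hi]
  rcases i with _ | j
  · simp [gaussNumber_zero]
  · rw [Nat.add_sub_cancel, gaussNumber_succ]; ring

theorem valency_eq (hc : HasClassicalParameters G bi ci D b α β) :
    (bi 0 : ℝ) = gaussNumber b D * β := by
  rw [hc.bi_eq D.zero_le, gaussNumber_zero]; ring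

theorem beta_sub_pos (hc : HasClassicalParameters G bi ci D b α β) (hb : 0 < b) {i : ℕ}
    (hi : i < D) : 0 < β - α * gaussNumber b i := by
  have h1 : (0 : ℝ) < bi i := Nat.cast_pos.2 (hc.1.bi_pos (hc.2.1 ▸ hi))
  rw [hc.bi_eq hi.le] at h1
  exact pos_of_mul_pos_right h1 (sub_pos.2 (gaussNumber_strictMono hb hi)).le

theorem one_add_pos (hc : HasClassicalParameters G bi ci D b α β) (hb : 0 < b) {i : ℕ}
    (hi : i < D) : 0 < 1 + α * gaussNumber b i := by
  have h1 : (0 : ℝ) < ci (i + 1) := Nat.cast_pos.2 (hc.1.ci_pos (hc.2.1 ▸ hi))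
  rw [hc.ci_eq (i := i + 1) hi, Nat.add_sub_cancel] at h1
  exact pos_of_mul_pos_right h1 (gaussNumber_nonneg hb _)

theorem beta_pos (hc : HasClassicalParameters G bi ci D b α β) (hb : 0 < b) (hD : 0 < D) :
    0 < β := by
  simpa [gaussNumber_zero] using hc.beta_sub_pos hb hD

end HasClassicalParameters

/-- The absolute values of the standard sequence of the smallest eigenvalue. -/
noncomputable def minCosineAbs (b α β : ℝ) (i : ℕ) : ℝ :=
  -- For `j < D` the factors are already positive; the absolute value keeps the sequence nonnegative
  -- beyond the diameter.
  ∏ j ∈ Finset.range i, |(1 + α * gaussNumber b j) / (β - α * gaussNumber b j)|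

theorem minCosineAbs_nonneg (b α β : ℝ) (i : ℕ) : 0 ≤ minCosineAbs b α β i :=
  Finset.prod_nonneg fun _ _ => abs_nonneg _

theorem minCosineAbs_zero (b α β : ℝ) : minCosineAbs b α β 0 = 1 := by simp [minCosineAbs]

namespace HasClassicalParameters

theorem minCosineAbs_succ_mul (hc : HasClassicalParameters G bi ci D b α β) (hb : 0 < b) {i : ℕ}
    (hi : i < D) : minCosineAbs b α β (i + 1) * (β - α * gaussNumber b i)
      = minCosineAbs b α β i * (1 + α * gaussNumber b i) := by
  have h1 := hc.beta_sub_pos hb hi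
  have h2 := hc.one_add_pos hb hi
  rw [minCosineAbs, Finset.prod_range_succ, ← minCosineAbs, abs_of_pos (div_pos h2 h1)]
  field_simp

theorem minCosineAbs_pos (hc : HasClassicalParameters G bi ci D b α β) (hb : 0 < b) {i : ℕ}
    (hi : i ≤ D) : 0 < minCosineAbs b α β i :=
  Finset.prod_pos fun j hj => by
    have hj' : j < D := (Finset.mem_range.1 hj).trans_le hi
    exact abs_pos.2 (div_pos (hc.one_add_pos hb hj') (hc.beta_sub_pos hb hj')).ne'

theorem minCosineAbs_recurrence (hc : HasClassicalParameters G bi ci D b α β) (hb : 0 < b)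
    {i : ℕ} (hi : i ≤ D) :
    (ci i : ℝ) * minCosineAbs b α β (i - 1)
        - ((bi 0 : ℝ) - bi i - ci i) * minCosineAbs b α β i + bi i * minCosineAbs b α β (i + 1)
      = gaussNumber b D * minCosineAbs b α β i := by
  have h1 : (ci i : ℝ) * minCosineAbs b α β (i - 1)
      = gaussNumber b i * (β - α * gaussNumber b (i - 1)) * minCosineAbs b α β i := by
    rw [hc.ci_eq hi]
    rcases i with _ | j
    · simp [gaussNumber_zero]
    · have := hc.minCosineAbs_succ_mul hb (i := j) hi
      rw [Nat.add_sub_cancel]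
      linear_combination -(gaussNumber b (j + 1)) * this
  have h2 : (bi i : ℝ) * minCosineAbs b α β (i + 1)
      = (gaussNumber b D - gaussNumber b i) * (1 + α * gaussNumber b i)
        * minCosineAbs b α β i := by
    rw [hc.bi_eq hi]
    rcases hi.lt_or_eq with h | h
    · have := hc.minCosineAbs_succ_mul hb h
      linear_combination (gaussNumber b D - gaussNumber b i) * this
    · rw [h]; ring
  rw [h1, h2, hc.valency_eq, hc.bi_eq hi, hc.ci_eq hi]
  ring

theorem minCosine_recurrence (hc : HasClassicalParameters G bi ci D b α β) (hb : 0 < b)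
    {i : ℕ} (hi : i ≤ D) :
    radialOp bi ci (fun j => (-1) ^ j * minCosineAbs b α β j) i
      = -gaussNumber b D * ((-1) ^ i * minCosineAbs b α β i) := by
  have h := hc.minCosineAbs_recurrence hb hi
  rcases i with _ | j
  · simp only [radialOp, hc.1.ci_zero] at h ⊢
    push_cast at h ⊢
    simp only [pow_zero, pow_succ]
    linear_combination -h
  · simp only [radialOp, Nat.add_sub_cancel] at h ⊢
    simp only [pow_succ]
    linear_combination (-1) ^ j * h

/-- The sequence `(-1) ^ i * minCosineAbs i` makes `-[D]` an eigenvalue, and its absolute values are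
the nonnegative vector giving the lower bound. -/
theorem isSmallestEigenvalue (hc : HasClassicalParameters G bi ci D b α β) (hb : 0 < b) :
    IsSmallestEigenvalue G (-gaussNumber b D) := by
  refine ⟨hc.1.mem_graphEigenvalues_of_radial
    (fun i hi => hc.minCosine_recurrence hb (hc.2.1 ▸ hi)) (by simp [minCosineAbs_zero]), ?_⟩
  intro θ hθ
  exact hc.1.neg_le_of_mem_graphEigenvalues (minCosineAbs_nonneg b α β)
    (by simp [minCosineAbs_zero]) (fun i hi => (hc.minCosineAbs_recurrence hb (hc.2.1 ▸ hi)).le) hθ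

theorem card_delsarteClique (hc : HasClassicalParameters G bi ci D b α β) (hb : 0 < b)
    (hD : 0 < D) {C : Finset V} (hC : IsDelsarteClique G C) : (C.card : ℝ) = 1 + β := by
  obtain ⟨-, k, θ, hk, hθ, hcard⟩ := hC
  obtain ⟨x⟩ := hc.1.1.nonempty
  have h1 : k = bi 0 := (hk x).symm.trans (hc.1.degree_eq x)
  have h2 : θ = -gaussNumber b D := hθ.unique (hc.isSmallestEigenvalue hb)
  have h3 : 0 < gaussNumber b D := by
    simpa [gaussNumber_zero] using gaussNumber_strictMono hb hD
  rw [hcard, h1, h2, hc.valency_eq, neg_neg]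
  field_simp

end HasClassicalParameters

/-! ### The cosine form on a vertex and a clique. -/

section Clique

-- Vertices of a clique are mutually adjacent, so only the distances `j` and `j + 1` from `x` occur.
omit [Fintype V] [DecidableEq V] [DecidableRel G.Adj] in
theorem sum_clique_radial (hconn : G.Connected) {C : Finset V} (hC : G.IsClique (C : Set V))
    {x : V} {j : ℕ} (hx : IsDistToSet G x C j) (F : ℕ → ℝ) :
    ∑ y ∈ C, F (G.dist x y) = ((C.filter fun y => G.dist x y = j).card : ℝ) * F j
      + ((C.card : ℝ) - (C.filter fun y => G.dist x y = j).card) * F (j + 1) := by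
  obtain ⟨⟨y₀, hy₀, hd₀⟩, hmin⟩ := hx
  have hpt : ∀ y ∈ C, F (G.dist x y)
      = F (j + 1) + (if G.dist x y = j then F j - F (j + 1) else 0) := by
    intro y hy
    split_ifs with h
    · rw [h]; ring
    · have h1 := hmin y hy
      have h2 := hconn.dist_triangle (u := x) (v := y₀) (w := y)
      have h3 : y₀ ≠ y := fun e => h (e ▸ hd₀)
      rw [SimpleGraph.dist_eq_one_iff_adj.2 (hC hy₀ hy h3), hd₀] at h2
      rw [add_zero, show G.dist x y = j + 1 by omega]
  rw [Finset.sum_congr rfl hpt, Finset.sum_add_distrib, ← Finset.sum_filter]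
  simp only [Finset.sum_const, nsmul_eq_mul]
  ring

/-- The right side is the positive semidefinite form `U` at the vector with weight `s` at `x` plus
weights `t (dist x y)` on `C`; the clique block is `(1 - v 1) I + v 1 J`. -/
theorem IsDistanceRegular.clique_quadForm_nonneg {bi ci : ℕ → ℕ}
    (h : IsDistanceRegular G bi ci) {θ : ℝ} {v : ℕ → ℝ}
    (hv : ∀ i ≤ G.diam, radialOp bi ci v i = θ * v i) (hv0 : v 0 = 1)
    {C : Finset V} (hC : G.IsClique (C : Set V)) (x : V) (s : ℝ) (t : ℕ → ℝ) :
    0 ≤ s ^ 2 + 2 * s * ∑ y ∈ C, t (G.dist x y) * v (G.dist x y)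
      + v 1 * (∑ y ∈ C, t (G.dist x y)) ^ 2 + (1 - v 1) * ∑ y ∈ C, t (G.dist x y) ^ 2 := by
  obtain ⟨γ, hγ, hQ⟩ := h.exists_pos_mul_quadForm_eq hv hv0
  set χ : V → ℝ := fun y => if y ∈ C then t (G.dist x y) else 0 with hχ
  set e : V → ℝ := fun y => if y = x then s else 0 with he
  have hQ1 := hQ (fun y => e y + χ y)
  have hnn : 0 ≤ ∑ y, ∑ z, (e y + χ y) * (e z + χ z) * v (G.dist y z) := by
    refine nonneg_of_mul_nonneg_right (a := γ) ?_ hγ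
    rw [hQ1]
    exact Finset.sum_nonneg fun _ _ => sq_nonneg _
  have hsplit : ∀ F : V → ℝ, ∑ y, (e y + χ y) * F y = s * F x + ∑ y ∈ C, t (G.dist x y) * F y := by
    intro F
    simp only [add_mul, Finset.sum_add_distrib, he, hχ, ite_mul, zero_mul, Finset.sum_ite_eq',
      Finset.mem_univ, if_true, Finset.sum_ite_mem, Finset.univ_inter]
  have hcl : ∀ y ∈ C, ∑ z ∈ C, t (G.dist x z) * v (G.dist y z)
      = v 1 * ∑ z ∈ C, t (G.dist x z) + (1 - v 1) * t (G.dist x y) := by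
    intro y hy
    have h1 : ∀ z ∈ C, t (G.dist x z) * v (G.dist y z)
        = v 1 * t (G.dist x z) + (if z = y then (1 - v 1) * t (G.dist x z) else 0) := by
      intro z hz
      split_ifs with hzy
      · rw [hzy, SimpleGraph.dist_self, hv0]; ring
      · rw [SimpleGraph.dist_eq_one_iff_adj.2 (hC hy hz (Ne.symm hzy))]; ring
    rw [Finset.sum_congr rfl h1, Finset.sum_add_distrib, ← Finset.mul_sum, Finset.sum_ite_eq',
      if_pos hy]
  have houter : ∑ y, ∑ z, (e y + χ y) * (e z + χ z) * v (G.dist y z)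
      = s * (s * v (G.dist x x) + ∑ z ∈ C, t (G.dist x z) * v (G.dist x z))
        + ∑ y ∈ C, t (G.dist x y) * (s * v (G.dist y x)
          + (v 1 * ∑ z ∈ C, t (G.dist x z) + (1 - v 1) * t (G.dist x y))) := by
    simp only [mul_assoc, ← Finset.mul_sum, hsplit]
    congr 1
    exact Finset.sum_congr rfl fun y hy => by rw [hcl y hy]
  rw [houter, SimpleGraph.dist_self, hv0] at hnn
  have hlast : ∑ y ∈ C, t (G.dist x y) * (s * v (G.dist y x)
          + (v 1 * ∑ z ∈ C, t (G.dist x z) + (1 - v 1) * t (G.dist x y)))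
      = s * ∑ y ∈ C, t (G.dist x y) * v (G.dist x y)
        + v 1 * (∑ y ∈ C, t (G.dist x y)) ^ 2 + (1 - v 1) * ∑ y ∈ C, t (G.dist x y) ^ 2 := by
    set T := ∑ y ∈ C, t (G.dist x y) with hT
    have hT2 : v 1 * T ^ 2 = ∑ y ∈ C, t (G.dist x y) * (v 1 * T) := by
      rw [← Finset.sum_mul, ← hT]; ring
    clear_value T
    rw [hT2, Finset.mul_sum _ _ s, Finset.mul_sum _ _ (1 - v 1), ← Finset.sum_add_distrib, ← Finset.sum_add_distrib]
    refine Finset.sum_congr rfl fun y _ => ?_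
    rw [SimpleGraph.dist_comm (u := y)]; ring
  rw [hlast] at hnn
  linarith

end Clique

end Classical

/-! ### Schur complement, the numbers `φ_j`, and the second largest eigenvalue. -/

section Classical

variable {V : Type*} [Fintype V] [DecidableEq V] {G : SimpleGraph V} [DecidableRel G.Adj]
  {bi ci : ℕ → ℕ} {D : ℕ} {b α β : ℝ}

/-- The Schur complement inequality for a vertex `x` and a clique at distance `j` from `x`. -/
theorem IsDistanceRegular.clique_cosine_le (h : IsDistanceRegular G bi ci) {θ : ℝ} {v : ℕ → ℝ}
    (hv : ∀ i ≤ G.diam, radialOp bi ci v i = θ * v i) (hv0 : v 0 = 1)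
    {C : Finset V} (hC : G.IsClique (C : Set V)) {x : V} {j : ℕ} (hx : IsDistToSet G x C j)
    {φ n : ℝ} (hφ : ((C.filter fun y => G.dist x y = j).card : ℝ) = φ) (hn : (C.card : ℝ) = n)
    (hA : 0 < 1 - v 1) (hB : 0 < 1 + (n - 1) * v 1) :
    (1 + (n - 1) * v 1) * (φ * v j ^ 2 + (n - φ) * v (j + 1) ^ 2)
        - v 1 * (φ * v j + (n - φ) * v (j + 1)) ^ 2
      ≤ (1 - v 1) * (1 + (n - 1) * v 1) := by
  set A := 1 - v 1 with hAdef
  set B := 1 + (n - 1) * v 1 with hBdef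
  set σ := φ * v j + (n - φ) * v (j + 1) with hσ
  -- The clique block has eigenvalues `A` and `B`. The weights on `C` are `A * B` times its inverse
  -- applied to the row of `x`, so the form becomes `A * B` times a scaled Schur complement.
  have key := h.clique_quadForm_nonneg hv hv0 hC x (-(A * B)) (fun i => B * v i - v 1 * σ)
  rw [sum_clique_radial h.1 hC hx (fun i => (B * v i - v 1 * σ) * v i),
    sum_clique_radial h.1 hC hx (fun i => B * v i - v 1 * σ),
    sum_clique_radial h.1 hC hx (fun i => (B * v i - v 1 * σ) ^ 2), hφ, hn] at key
  have hmul : 0 ≤ (A * B) * (A * B - (B * (φ * v j ^ 2 + (n - φ) * v (j + 1) ^ 2)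
      - v 1 * σ ^ 2)) := by
    have hn' : n * v 1 = B - A := by rw [hAdef, hBdef]; ring
    refine key.trans_eq ?_
    rw [← hAdef]
    have h1 : φ * (B * v j - v 1 * σ) + (n - φ) * (B * v (j + 1) - v 1 * σ) = A * σ := by
      linear_combination (-B) * hσ - σ * hn'
    have h2 : φ * ((B * v j - v 1 * σ) * v j) + (n - φ) * ((B * v (j + 1) - v 1 * σ) * v (j + 1))
        = B * (φ * v j ^ 2 + (n - φ) * v (j + 1) ^ 2) - v 1 * σ ^ 2 := by
      linear_combination (v 1 * σ) * hσ
    have h3 : φ * (B * v j - v 1 * σ) ^ 2 + (n - φ) * (B * v (j + 1) - v 1 * σ) ^ 2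
        = B * (B * (φ * v j ^ 2 + (n - φ) * v (j + 1) ^ 2) - v 1 * σ ^ 2)
          - v 1 * A * σ ^ 2 := by
      linear_combination (2 * B * v 1 * σ) * hσ + (v 1 * σ ^ 2) * hn'
    rw [h1, h2, h3]
    ring
  have := nonneg_of_mul_nonneg_right hmul (mul_pos hA hB)
  linarith

/-- The Schur complement inequality in terms of `E = (1 - u₁) / (u_j - u_{j+1})`. -/
theorem sq_ge_of_cosine_le {u w₀ w₁ δ E φ β : ℝ} (hu : 0 < u) (hδ : 0 < δ)
    (hw : w₀ = w₁ + δ) (hE : 1 - u = E * δ)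
    (h : (1 + β * u) * (φ * w₀ ^ 2 + (1 + β - φ) * w₁ ^ 2)
        - u * (φ * w₀ + (1 + β - φ) * w₁) ^ 2 ≤ (1 - u) * (1 + β * u)) :
    (φ - E * w₁ / u) ^ 2 ≥ (β + 1 / u) * (φ + E * (w₁ ^ 2 - u) / (δ * u)) := by
  subst hw
  have hid : δ * ((φ - E * w₁ / u) ^ 2 - (β + 1 / u) * (φ + E * (w₁ ^ 2 - u) / (δ * u))) * (u * δ)
      = ((1 - u) * (1 + β * u) - ((1 + β * u) * (φ * (w₁ + δ) ^ 2 + (1 + β - φ) * w₁ ^ 2)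
        - u * (φ * (w₁ + δ) + (1 + β - φ) * w₁) ^ 2)) := by
    have hne := hu.ne'
    have hδne := hδ.ne'
    obtain rfl : E = (1 - u) / δ := by rw [hE]; field_simp
    field_simp
    ring
  have h1 : 0 < δ * (u * δ) := by positivity
  have h2 : 0 ≤ (δ * (u * δ)) * ((φ - E * w₁ / u) ^ 2
      - (β + 1 / u) * (φ + E * (w₁ ^ 2 - u) / (δ * u))) := by
    linarith
  linarith [nonneg_of_mul_nonneg_right h2 h1]

namespace HasClassicalParameters

/-- The row sums of the `θ_min` cosine matrix over a Delsarte clique vanish, so `φ_j v_j + (1 + β -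
φ_j) v_{j+1} = 0`; the known ratio `v_{j+1} / v_j` then determines `φ_j`. -/
theorem phi_eq (hc : HasClassicalParameters G bi ci D b α β) (hb : 0 < b) {j p : ℕ}
    (hj : j < D) (hp : IsGeometricPhi G j p) : (p : ℝ) = 1 + α * gaussNumber b j := by
  obtain ⟨C, x, hC, hx, hcard⟩ := hp
  have hD : 0 < D := by omega
  have hn := hc.card_delsarteClique hb hD hC
  have hβ := hc.beta_pos hb hD
  set v : ℕ → ℝ := fun j => (-1) ^ j * minCosineAbs b α β j with hv
  have hrec : ∀ i ≤ G.diam, radialOp bi ci v i = -gaussNumber b D * v i := fun i hi =>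
    hc.minCosine_recurrence hb (hc.2.1 ▸ hi)
  have hv0 : v 0 = 1 := by simp [hv, minCosineAbs_zero]
  have hv1 : v 1 * β = -1 := by
    have := hc.minCosineAbs_succ_mul hb hD
    simp only [gaussNumber_zero, mul_zero, sub_zero, minCosineAbs_zero, zero_add, add_zero] at this
    simp only [hv, pow_one]
    linarith
  have hsum : ∑ y ∈ C, 1 * v (G.dist x y) = 0 := by
    -- The all-ones vector of `C` is isotropic because `v 1 = -1 / β`; with this `s` the form equals
    -- minus the square of the row sum.
    have h1 := hc.1.clique_quadForm_nonneg hrec hv0 hC.1 x (-∑ y ∈ C, 1 * v (G.dist x y))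
      (fun _ => 1)
    simp only [Finset.sum_const, nsmul_eq_mul, mul_one, one_pow, hn] at h1
    have h2 : v 1 * (1 + β) ^ 2 + (1 - v 1) * (1 + β) = 0 := by
      linear_combination (1 + β) * hv1
    exact pow_eq_zero_iff two_ne_zero |>.1 (le_antisymm (by linarith) (sq_nonneg _))
  simp only [one_mul] at hsum
  rw [sum_clique_radial hc.1.1 hC.1 hx, hcard, hn] at hsum
  have hm := hc.minCosineAbs_pos hb hj.le
  have h1 := hc.minCosineAbs_succ_mul hb hj
  have h2 : (p : ℝ) * minCosineAbs b α β j = (1 + β - p) * minCosineAbs b α β (j + 1) := by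
    have h3 : (-1 : ℝ) ^ j * ((p : ℝ) * minCosineAbs b α β j
        - (1 + β - p) * minCosineAbs b α β (j + 1)) = 0 := by
      rw [← hsum]; simp only [hv, pow_succ]; ring
    exact sub_eq_zero.1 ((mul_eq_zero.1 h3).resolve_left (by simp))
  have h4 : (minCosineAbs b α β j * (1 + β)) * ((p : ℝ) - (1 + α * gaussNumber b j)) = 0 := by
    linear_combination (β - α * gaussNumber b j) * h2 + (1 + β - p) * h1
  exact sub_eq_zero.1 ((mul_eq_zero.1 h4).resolve_left (by positivity))

end HasClassicalParameters

/-- The second largest eigenvalue of a graph with classical parameters. -/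
noncomputable def classicalTheta (D : ℕ) (b α β : ℝ) : ℝ :=
  (gaussNumber b D - 1) / b * (β - α) - 1

/-- Its standard sequence. -/
noncomputable def classicalCosine (D : ℕ) (b α β : ℝ) (i : ℕ) : ℝ :=
  1 - (1 - classicalTheta D b α β / (gaussNumber b D * β)) * ∑ j ∈ Finset.range i, b⁻¹ ^ j

theorem inv_pow_mul_gaussNumber (hb : 0 < b) (i : ℕ) :
    b⁻¹ ^ i * (1 + (b - 1) * gaussNumber b i) = 1 := by
  rw [sub_one_mul_gaussNumber, add_sub_cancel, inv_pow, inv_mul_cancel₀ (pow_pos hb i).ne']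

namespace HasClassicalParameters

theorem classicalCosine_recurrence (hc : HasClassicalParameters G bi ci D b α β) (hb : 0 < b)
    (hD : 0 < D) {i : ℕ} (hi : i ≤ D) :
    radialOp bi ci (classicalCosine D b α β) i
      = classicalTheta D b α β * classicalCosine D b α β i := by
  have hk : 0 < gaussNumber b D * β := by
    rw [← hc.valency_eq]; exact Nat.cast_pos.2 (hc.1.bi_pos (hc.2.1 ▸ hD))
  have hq := inv_pow_mul_gaussNumber hb i
  set ε := 1 - classicalTheta D b α β / (gaussNumber b D * β) with hε
  have hkε : gaussNumber b D * β * ε = gaussNumber b D * β - classicalTheta D b α β := by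
    rw [hε, mul_sub, mul_one, mul_div_assoc', mul_div_cancel_left₀ _ hk.ne']
  have h1 : classicalCosine D b α β (i + 1) - classicalCosine D b α β i = -(ε * b⁻¹ ^ i) := by
    rw [classicalCosine, classicalCosine, ← hε, Finset.sum_range_succ]; ring
  have h2 : (ci i : ℝ) * (classicalCosine D b α β (i - 1) - classicalCosine D b α β i)
      = ε * b⁻¹ ^ i * (gaussNumber b i * (b + α * (gaussNumber b i - 1))) := by
    rw [← hc.mul_ci_eq hi]
    rcases i with _ | j
    · simp [hc.1.ci_zero]
    · rw [Nat.add_sub_cancel, classicalCosine, classicalCosine, ← hε, Finset.sum_range_succ,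
        pow_succ]
      field_simp
      ring
  have h3 : classicalCosine D b α β i = 1 - ε * (b * b⁻¹ ^ i * gaussNumber b i) := by
    rw [classicalCosine, ← hε, sum_inv_pow_eq hb]
  have hθ : b * classicalTheta D b α β = (gaussNumber b D - 1) * (β - α) - b := by
    rw [classicalTheta]; field_simp
  rw [radialOp, h1, h2, h3, hc.valency_eq, hc.bi_eq hi]
  generalize classicalTheta D b α β = θ at *
  generalize b⁻¹ ^ i = q at *
  generalize gaussNumber b i = g at *
  generalize gaussNumber b D = K at *
  have e : K * β * (1 - ε * (b * q * g)) - θ * (1 - ε * (b * q * g))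
      = K * β * ε * (1 - ε * (b * q * g)) := by rw [hkε]; ring
  linear_combination e - ε * b * q * g * hkε + ε * q * g * hθ - ε * K * β * hq

/-- Successive differences of `classicalCosine` are proportional to `b⁻¹ ^ i`, a positive
eigenvector of the difference matrix, so the bound holds with equality in every row. -/
theorem le_classicalTheta (hc : HasClassicalParameters G bi ci D b α β) (hb : 0 < b)
    (hD : 0 < D) {θ : ℝ} (hθ : θ ∈ graphEigenvalues G) (hne : θ ≠ bi 0) :
    θ ≤ classicalTheta D b α β := by
  refine hc.1.le_of_mem_graphEigenvalues_of_ne (m := fun i => b⁻¹ ^ i) (fun i => by positivity)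
    (by simp) (hc.2.1 ▸ hD) (fun i hi => ?_) hθ hne
  rw [hc.2.1] at hi
  have h1 : (ci i : ℝ) * b⁻¹ ^ (i - 1)
      = b⁻¹ ^ i * (gaussNumber b i * (b + α * (gaussNumber b i - 1))) := by
    rw [← hc.mul_ci_eq hi.le]
    rcases i with _ | j
    · simp [hc.1.ci_zero]
    · rw [Nat.add_sub_cancel, pow_succ]
      field_simp
  rw [h1, hc.valency_eq, hc.bi_eq hi.le, hc.bi_eq (i := i + 1) hi, hc.ci_eq (i := i + 1) hi,
    Nat.add_sub_cancel, gaussNumber_succ, classicalTheta, pow_succ]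
  apply le_of_eq
  field_simp
  ring

theorem eq_classicalTheta (hc : HasClassicalParameters G bi ci D b α β) (hb : 0 < b)
    (hD : 0 < D) (hα : 0 ≤ α) {θ : ℝ} (hθ : IsSecondLargestEigenvalue G θ) :
    θ = classicalTheta D b α β ∧ classicalTheta D b α β < bi 0 := by
  have hβ := hc.beta_pos hb hD
  have hlt : classicalTheta D b α β < bi 0 := by
    obtain ⟨n, rfl⟩ := Nat.exists_eq_succ_of_ne_zero hD.ne'
    rw [hc.valency_eq, classicalTheta, Nat.succ_eq_add_one, gaussNumber_succ, add_sub_cancel_left,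
      mul_div_cancel_left₀ _ hb.ne', ← gaussNumber_succ]
    -- With `D = n + 1`, `k - θ = ([n + 1] - [n]) β + [n] α + 1`; this is where `α ≥ 0` enters.
    have h1 := gaussNumber_strictMono hb (Nat.lt_succ_self n)
    have h2 := gaussNumber_nonneg hb n
    nlinarith [mul_nonneg h2 hα, mul_pos (sub_pos.2 h1) hβ]
  have hk : (bi 0 : ℝ) ∈ graphEigenvalues G :=
    hc.1.mem_graphEigenvalues_of_radial (v := fun _ => 1) (fun i _ => by simp [radialOp])
      one_ne_zero
  have hmem : classicalTheta D b α β ∈ graphEigenvalues G :=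
    hc.1.mem_graphEigenvalues_of_radial (v := classicalCosine D b α β)
      (fun i hi => hc.classicalCosine_recurrence hb hD (hc.2.1 ▸ hi))
      (by simp [classicalCosine])
  obtain ⟨θ₀, hθ₀, hθ⟩ := hθ
  have h0 : θ₀ = bi 0 := by
    by_contra hne
    exact absurd ((hθ₀.2 hk).trans (hc.le_classicalTheta hb hD hθ₀.1 hne)) (not_le.2 hlt)
  subst h0
  exact ⟨le_antisymm (hc.le_classicalTheta hb hD hθ.1.1 hθ.1.2) (hθ.2 ⟨hmem, hlt.ne⟩), hlt⟩

end HasClassicalParameters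

theorem IsDistanceRegular.standardSequence_unique (h : IsDistanceRegular G bi ci) (hD : G.diam = D)
    {θ : ℝ} {u v : ℕ → ℝ} (hu : IsStandardSequence bi ci D θ u)
    (hv : ∀ i ≤ D, radialOp bi ci v i = θ * v i) (hv0 : v 0 = 1) : ∀ i ≤ D, u i = v i := by
  intro i
  induction i using Nat.strong_induction_on with
  | _ i ih =>
    intro hi
    rcases i with _ | _ | i
    · rw [hu.1, hv0]
    · have h1 := hv 0 (Nat.zero_le _)
      have h2 : (0 : ℝ) < bi 0 := Nat.cast_pos.2 (h.bi_pos (by omega))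
      simp only [radialOp, h.ci_zero, hv0] at h1
      rw [hu.2.1, div_eq_iff h2.ne']
      push_cast at h1
      linarith
    · have h1 := hv (i + 1) (by omega)
      have h2 : (0 : ℝ) < bi (i + 1) := Nat.cast_pos.2 (h.bi_pos (by omega))
      have h3 := hu.2.2 (i + 1) (by omega) (by omega)
      rw [Nat.add_sub_cancel, ih i (by omega) (by omega), ih (i + 1) (by omega) (by omega)] at h3
      rw [radialOp, Nat.add_sub_cancel] at h1
      refine mul_left_cancel₀ h2.ne' ?_
      linarith

end Classical

/-! ### Numerical estimates for `b ≥ 2`. -/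

/-- In the case `α ≥ b ^ 2 + 2 b`, the number `t = 1 / u₁` is at most `b ^ 2 + b + 1`. -/
theorem inv_cosine_le {b α β g : ℝ} (hb : 2 ≤ b) (hα : b ^ 2 + 2 * b ≤ α) (hg : 1 ≤ g)
    (hβ : α * (1 + b * g) < β) :
    (1 + b * (1 + b * g)) * β / ((1 + b * g) * (β - α) - 1) ≤ b ^ 2 + b + 1 := by
  have hbg : 0 ≤ b * g := by positivity
  have hβ1 : 1 ≤ β := by nlinarith [mul_nonneg (show (0 : ℝ) ≤ α by nlinarith) hbg]
  -- Here `g = [D - 2]`, so `1 + b g = [D - 1]`, and `α [D - 1] < β` lets `β` absorb the term in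
  -- `α`.
  have h1 : b * g * β - 1 ≤ (1 + b * g) * (β - α) - 1 := by nlinarith
  have h2 : 0 < b * g * β - 1 := by
    have : 2 ≤ b * g := by nlinarith
    nlinarith
  rw [div_le_iff₀ (h2.trans_le h1)]
  refine le_trans ?_ (mul_le_mul_of_nonneg_left h1 (by positivity))
  have h3 : 0 ≤ (b ^ 3 + b) * β * (g - 1) :=
    mul_nonneg (by positivity) (by linarith)
  have h4 : 0 ≤ (b ^ 2 + b + 1) * (β * (b - 1) - 1) :=
    mul_nonneg (by positivity) (by nlinarith)
  nlinarith

/-- For `α < b ^ 2 + 2 b` both right sides are nonpositive. Otherwise `t ≤ b ^ 2 + b + 1` bounds the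
squares in `h₁` and `h₂` from above, and dropping `t > 0` only lowers their right sides. -/
theorem sq_ge_of_small {b α β t φ₁ φ₂ : ℝ} (hb : 2 ≤ b) (hβ : 0 < β) (ht : 0 < t)
    (hφ₁ : φ₁ = 1 + α) (hφ₂ : φ₂ = 1 + α * (1 + b))
    (htle : b ^ 2 + 2 * b ≤ α → t ≤ b ^ 2 + b + 1)
    (h₁ : (α - b + t) ^ 2 ≥ (β + t) * (α - b ^ 2 - 2 * b + t))
    (h₂ : ((1 + b) * (α - b + t)) ^ 2
      ≥ (β + t) * (α * (1 + b) + (1 + b) ^ 2 * t - b * (b + 1) * (b ^ 2 + b + 2))) :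
    (φ₁ + 7 * b ^ 2 / 2) ^ 2 ≥ β * (φ₁ - b ^ 2 - 2 * b - 1) ∧
    (φ₂ + 7 * b ^ 3 / 2) ^ 2 ≥ β * (φ₂ - b ^ 4 - 11 * b ^ 3 / 2 - b ^ 2 - 1) := by
  subst hφ₁ hφ₂
  rcases lt_or_ge α (b ^ 2 + 2 * b) with hlt | hge
  · refine ⟨(mul_nonpos_of_nonneg_of_nonpos hβ.le (by linarith)).trans (sq_nonneg _),
      (mul_nonpos_of_nonneg_of_nonpos hβ.le ?_).trans (sq_nonneg _)⟩
    have h1 : α * (1 + b) ≤ (b ^ 2 + 2 * b) * (1 + b) :=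
      mul_le_mul_of_nonneg_right hlt.le (by linarith)
    have h2 : 0 ≤ b ^ 2 * (b - 2) := by have : 0 ≤ b - 2 := by linarith
                                        positivity
    have h3 : 0 ≤ b * (b - 2) := by nlinarith
    have h4 : 0 ≤ b ^ 4 := by positivity
    nlinarith
  · have ht' := htle hge
    have hpos : 0 ≤ α - b + t := by nlinarith
    constructor
    · have h3 : (α - b + t) ^ 2 ≤ (1 + α + 7 * b ^ 2 / 2) ^ 2 :=
        pow_le_pow_left₀ hpos (by nlinarith) 2
      have h4 : β * (1 + α - b ^ 2 - 2 * b - 1) ≤ (β + t) * (α - b ^ 2 - 2 * b + t) :=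
        mul_le_mul (by linarith) (by linarith) (by linarith) (by linarith)
      linarith
    · have hb2 : 0 ≤ b * (b - 2) := by nlinarith
      have hb3 : 0 ≤ b ^ 2 * (b - 2) := by
        have : 0 ≤ b - 2 := by linarith
        positivity
      have h3 : ((1 + b) * (α - b + t)) ^ 2 ≤ (1 + α * (1 + b) + 7 * b ^ 3 / 2) ^ 2 := by
        refine pow_le_pow_left₀ (mul_nonneg (by linarith) hpos) ?_ 2
        have h5 : (1 + b) * (t - b) ≤ (1 + b) * (b ^ 2 + 1) :=
          mul_le_mul_of_nonneg_left (by linarith) (by linarith)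
        nlinarith
      rcases le_total (1 + α * (1 + b) - b ^ 4 - 11 * b ^ 3 / 2 - b ^ 2 - 1) 0 with hn | hn
      · exact (mul_nonpos_of_nonneg_of_nonpos hβ.le hn).trans (sq_nonneg _)
      · have h6 : 1 + α * (1 + b) - b ^ 4 - 11 * b ^ 3 / 2 - b ^ 2 - 1
            ≤ α * (1 + b) + (1 + b) ^ 2 * t - b * (b + 1) * (b ^ 2 + b + 2) := by
          have : 0 ≤ (1 + b) ^ 2 * t := by positivity
          nlinarith
        have h4 := mul_le_mul (show β ≤ β + t by linarith) h6 hn (by linarith)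
        linarith

/-! ### The main theorem. -/

theorem mainTheorem11 {V : Type*} [Fintype V] [DecidableEq V] (G : SimpleGraph V)
    [DecidableRel G.Adj] (bi ci : ℕ → ℕ) (D : ℕ) (b α β : ℝ)
    (hD : 3 ≤ D) (hb : 0 < b)
    (hclassical : HasClassicalParameters G bi ci D b α β)
    (hgeometric : IsGeometric G)
    (θ₁ : ℝ) (hθ₁ : IsSecondLargestEigenvalue G θ₁)
    (u : ℕ → ℝ) (hu : IsStandardSequence bi ci D θ₁ u)
    (φ₁ φ₂ : ℕ) (hφ₁ : IsGeometricPhi G 1 φ₁) (hφ₂ : IsGeometricPhi G 2 φ₂) :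
    u 1 ≠ 0 ∧
    ((φ₁ : ℝ) - b * u 2 / u 1) ^ 2
        ≥ (β + 1 / u 1) * ((φ₁ : ℝ) - b ^ 2 - 2 * b - 1 + 1 / u 1) ∧
    ((φ₂ : ℝ) - b ^ 2 * u 3 / u 1) ^ 2
        ≥ (β + 1 / u 1) * ((φ₂ : ℝ) - b ^ 4 - 2 * b ^ 3
            - b ^ 2 * (1 + (2 * u 2 - 1) / u 1) - 1 + 1 / u 1) ∧
    (2 ≤ b →
      ((φ₁ : ℝ) + 7 * b ^ 2 / 2) ^ 2 ≥ β * ((φ₁ : ℝ) - b ^ 2 - 2 * b - 1) ∧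
      ((φ₂ : ℝ) + 7 * b ^ 3 / 2) ^ 2
        ≥ β * ((φ₂ : ℝ) - b ^ 4 - 11 * b ^ 3 / 2 - b ^ 2 - 1)) := by
  have hD0 : 0 < D := by omega
  have hβ := hclassical.beta_pos hb hD0
  have hphi₁ := hclassical.phi_eq hb (by omega) hφ₁
  have hphi₂ := hclassical.phi_eq hb (by omega) hφ₂
  rw [gaussNumber_one, mul_one] at hphi₁
  rw [gaussNumber_two] at hphi₂
  obtain ⟨C₁, x₁, hC₁, hx₁, hcard₁⟩ := hφ₁
  obtain ⟨C₂, x₂, hC₂, hx₂, hcard₂⟩ := hφ₂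
  have hn₁ := hclassical.card_delsarteClique hb hD0 hC₁
  have hn₂ := hclassical.card_delsarteClique hb hD0 hC₂
  have hα : 0 ≤ α := by
    have h1 : 1 ≤ φ₁ := by
      obtain ⟨⟨y, hy, hyd⟩, -⟩ := hx₁
      rw [← hcard₁]
      exact Finset.card_pos.2 ⟨y, Finset.mem_filter.2 ⟨hy, hyd⟩⟩
    have h2 : (1 : ℝ) ≤ φ₁ := by exact_mod_cast h1
    linarith
  -- Integrality: `φ₁ = 1 + α` is strictly less than `|C| = 1 + β`, so the gap is at least 1. This
  -- yields `θ₁ ≥ b g > 0`, hence `u 1 > 0`.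
  have hβα : 1 ≤ β - α := by
    have h1 := hclassical.beta_sub_pos hb (i := 1) (by omega)
    rw [gaussNumber_one, mul_one] at h1
    have h2 : (φ₁ : ℝ) < C₁.card := by linarith
    have h3 : ((φ₁ + 1 : ℕ) : ℝ) ≤ C₁.card := by
      exact_mod_cast Nat.succ_le_of_lt (by exact_mod_cast h2)
    push_cast at h3
    linarith
  obtain ⟨hθ, hlt⟩ := hclassical.eq_classicalTheta hb hD0 hα hθ₁
  subst hθ
  obtain ⟨m, rfl⟩ : ∃ m, D = m + 3 := ⟨D - 3, by omega⟩
  set g := gaussNumber b (m + 1) with hg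
  have hg1 : 1 ≤ g := by
    rw [hg, gaussNumber_succ]
    have := mul_nonneg hb.le (gaussNumber_nonneg hb m)
    linarith
  have hG2 : gaussNumber b (m + 2) = 1 + b * g := gaussNumber_succ b (m + 1)
  have hG3 : gaussNumber b (m + 3) = 1 + b * (1 + b * g) := by rw [gaussNumber_succ, hG2]
  have hθeq : classicalTheta (m + 3) b α β = (1 + b * g) * (β - α) - 1 := by
    rw [classicalTheta, hG3, add_sub_cancel_left, mul_div_cancel_left₀ _ hb.ne']
  have hbg : 0 < b * g := by positivity
  have hθpos : 0 < classicalTheta (m + 3) b α β := by rw [hθeq]; nlinarith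
  set v := classicalCosine (m + 3) b α β with hv
  have hv0 : v 0 = 1 := by simp [hv, classicalCosine]
  have hrec : ∀ i ≤ m + 3, radialOp bi ci v i = classicalTheta (m + 3) b α β * v i :=
    fun i hi => hclassical.classicalCosine_recurrence hb hD0 hi
  have huv := hclassical.1.standardSequence_unique hclassical.2.1 hu hrec hv0
  have hk : (bi 0 : ℝ) = (1 + b * (1 + b * g)) * β := by rw [hclassical.valency_eq, hG3]
  have hkpos : (0 : ℝ) < bi 0 := hθpos.trans hlt
  have hu1 : u 1 = classicalTheta (m + 3) b α β / bi 0 := hu.2.1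
  have hupos : 0 < u 1 := by rw [hu1]; positivity
  have hult : 0 < 1 - u 1 := by rw [hu1, sub_pos, div_lt_one hkpos]; exact hlt
  have hε : ∀ i, v i = 1 - (1 - u 1) * ∑ j ∈ Finset.range i, b⁻¹ ^ j := fun i => by
    rw [hv, classicalCosine, hu1, hclassical.valency_eq]
  have hu2 : u 2 = u 1 - (1 - u 1) / b := by
    rw [huv 2 (by omega), hε]
    simp only [Finset.sum_range_succ, Finset.sum_range_zero]
    field_simp
    ring
  have hu3 : u 3 = u 2 - (1 - u 1) / b ^ 2 := by
    rw [hu2, huv 3 (by omega), hε]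
    simp only [Finset.sum_range_succ, Finset.sum_range_zero]
    field_simp
    ring
  have hrec' : ∀ i ≤ G.diam, radialOp bi ci v i = classicalTheta (m + 3) b α β * v i :=
    fun i hi => hrec i (hclassical.2.1 ▸ hi)
  have hne := hupos.ne'
  have hεne := hult.ne'
  have hv1 : v 1 = u 1 := (huv 1 (by omega)).symm
  have hv2 : v 2 = u 2 := (huv 2 (by omega)).symm
  have hv3 : v 3 = u 3 := (huv 3 (by omega)).symm
  have hB : 0 < 1 + (1 + β - 1) * v 1 := by
    rw [hv1, add_sub_cancel_left]; positivity
  have main₁ : ((φ₁ : ℝ) - b * u 2 / u 1) ^ 2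
      ≥ (β + 1 / u 1) * ((φ₁ : ℝ) - b ^ 2 - 2 * b - 1 + 1 / u 1) := by
    have h := hclassical.1.clique_cosine_le hrec' hv0 hC₁.1 hx₁ (congrArg Nat.cast hcard₁) hn₁
      (by rwa [hv1]) hB
    rw [hv1, hv2, add_sub_cancel_left] at h
    -- `δ = u 1 - u 2`, so `E = (1 - u 1) / δ` is `b`; for `j = 2` it becomes `b ^ 2`.
    have h' := sq_ge_of_cosine_le (δ := (1 - u 1) / b) (E := b) hupos (by positivity)
      (by rw [hu2]; ring) (by field_simp) h
    have e : (φ₁ : ℝ) + b * (u 2 ^ 2 - u 1) / ((1 - u 1) / b * u 1)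
        = (φ₁ : ℝ) - b ^ 2 - 2 * b - 1 + 1 / u 1 := by
      rw [hu2]; field_simp; ring
    rwa [e] at h'
  have main₂ : ((φ₂ : ℝ) - b ^ 2 * u 3 / u 1) ^ 2
      ≥ (β + 1 / u 1) * ((φ₂ : ℝ) - b ^ 4 - 2 * b ^ 3
          - b ^ 2 * (1 + (2 * u 2 - 1) / u 1) - 1 + 1 / u 1) := by
    have h := hclassical.1.clique_cosine_le hrec' hv0 hC₂.1 hx₂ (congrArg Nat.cast hcard₂) hn₂
      (by rwa [hv1]) hB
    rw [hv1, hv2, hv3, add_sub_cancel_left] at h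
    have h' := sq_ge_of_cosine_le (δ := (1 - u 1) / b ^ 2) (E := b ^ 2) hupos (by positivity)
      (by rw [hu3]; ring) (by field_simp) h
    have e : (φ₂ : ℝ) + b ^ 2 * (u 3 ^ 2 - u 1) / ((1 - u 1) / b ^ 2 * u 1)
        = (φ₂ : ℝ) - b ^ 4 - 2 * b ^ 3 - b ^ 2 * (1 + (2 * u 2 - 1) / u 1) - 1 + 1 / u 1 := by
      rw [hu3, hu2]; field_simp; ring
    rwa [e] at h'
  refine ⟨hne, main₁, main₂, fun hb2 => ?_⟩
  refine sq_ge_of_small (t := 1 / u 1) hb2 hβ (by positivity) hphi₁ hphi₂ (fun hge => ?_) ?_ ?_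
  · have h1 := hclassical.beta_sub_pos hb (i := m + 2) (by omega)
    rw [hG2, sub_pos] at h1
    have h2 := inv_cosine_le hb2 hge hg1 h1
    rwa [hu1, one_div_div, hk, hθeq]
  · have e1 : (φ₁ : ℝ) - b * u 2 / u 1 = α - b + 1 / u 1 := by
      rw [hphi₁, hu2]; field_simp; ring
    have e2 : (φ₁ : ℝ) - b ^ 2 - 2 * b - 1 + 1 / u 1 = α - b ^ 2 - 2 * b + 1 / u 1 := by
      rw [hphi₁]; ring
    rwa [e1, e2] at main₁
  · have e1 : (φ₂ : ℝ) - b ^ 2 * u 3 / u 1 = (1 + b) * (α - b + 1 / u 1) := by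
      rw [hphi₂, hu3, hu2]; field_simp; ring
    have e2 : (φ₂ : ℝ) - b ^ 4 - 2 * b ^ 3 - b ^ 2 * (1 + (2 * u 2 - 1) / u 1) - 1 + 1 / u 1
        = α * (1 + b) + (1 + b) ^ 2 * (1 / u 1) - b * (b + 1) * (b ^ 2 + b + 2) := by
      rw [hphi₂, hu2]; field_simp; ring
    rwa [e1, e2] at main₂
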